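/- Let $N\ge 2$ and $q=2(N+1)/(N-1)$. Let $d\omega$ be the surface measure on the unit sphere $\mathbb S^{N-1}\subset\mathbb R^N$, let $L^2(\mathbb S^{N-1})$ be the space of complex-valued square-integrable functions with norm $\|\cdot\|$, and for $f\in L^2(\mathbb S^{N-1})$ put $$\check f(x)=(2\pi)^{-N/2}\int_{\mathbb S^{N-1}}e^{ix\cdot\omega}f(\omega)\,d\omega\qquad(x\in\mathbb R^N).$$ Define the optimal Stein--Tomas constant $$\mathcal R_N=\sup_{0\ne f\in L^2(\mathbb S^{N-1})}\frac{\int_{\mathbb R^N}|\check f|^q\,dx}{\|f\|^q}.$$ For a sequence $(f_n)\subset L^2(\mathbb S^{N-1})$ write $f_n\rightharpoonup_{\mathrm{mod}}0$ if for every sequence $(a_n)\subset\mathbb R^N$ the functions $e^{-ia_n\cdot\omega}f_n(\omega)$ converge weakly to $0$ in $L^2(\mathbb S^{N-1})$, and define $$\mathcal R_N^*=\sup\Big\{\limsup_{n\to\infty}\int_{\mathbb R^N}|\check f_n|^q\,dx:\ \|f_n\|=1\text{ for all }n,\ f_n\rightharpoonup_{\mathrm{mod}}0\Big\}.$$ (Both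 suprema are taken in $[0,\infty]$.) If $\mathcal R_N>\mathcal R_N^*$, then: 1. maximizing sequences for $\mathcal R_N$, normalized in $L^2(\mathbb S^{N-1})$, are precompact up to modulations: whenever $\|f_n\|=1$ for all $n$ and $\int_{\mathbb R^N}|\check f_n|^q\,dx\to\mathcal R_N$, there are a subsequence $(f_{n_k})$ and a sequence $(a_k)\subset\mathbb R^N$ such that $e^{-ia_k\cdot\omega}f_{n_k}$ converges in the norm of $L^2(\mathbb S^{N-1})$; 2. there is a maximizer for $\mathcal R_N$, that is, a function $0\ne f\in L^2(\mathbb S^{N-1})$ with $\int_{\mathbb R^N}|\check f|^q\,dx=\mathcal R_N\|f\|^q$. -/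

import Mathlib

open MeasureTheory Filter Topology
open scoped ENNReal

namespace SteinTomas

noncomputable section

/-- Euclidean space `ℝ^N`. -/
abbrev Space (N : ℕ) : Type := EuclideanSpace ℝ (Fin N)

/-- The unit sphere `𝕊^{N-1}` of `ℝ^N`. -/
abbrev Sphere (N : ℕ) : Type := Metric.sphere (0 : Space N) 1

/-- The (non-normalized) surface measure `dω` on `𝕊^{N-1}`. -/
abbrev surfaceMeasure (N : ℕ) : Measure (Sphere N) :=
  (volume : Measure (Space N)).toSphere

/-- The complex Hilbert space `L²(𝕊^{N-1})`. -/
abbrev L2Sphere (N : ℕ) : Type := Lp ℂ 2 (surfaceMeasure N)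

/-- The Stein-Tomas exponent `q = 2(N+1)/(N-1)`. -/
def exponent (N : ℕ) : ℝ := 2 * ((N : ℝ) + 1) / ((N : ℝ) - 1)

/-- The inverse Fourier transform of `f dω`:
`x ↦ (2π)^{-N/2} ∫ e^{i x·ω} f(ω) dω`. -/
def extension {N : ℕ} (f : L2Sphere N) (x : Space N) : ℂ :=
  (((2 * Real.pi) ^ (-(N : ℝ) / 2) : ℝ) : ℂ) *
    ∫ ω : Sphere N, Complex.exp (Complex.I * ((inner ℝ x (ω : Space N) : ℝ) : ℂ)) * f ω
      ∂(surfaceMeasure N)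

/-- The quantity `∫_{ℝ^N} |f̌(x)|^q dx`, as an extended nonnegative number. -/
def energy {N : ℕ} (f : L2Sphere N) : ℝ≥0∞ :=
  ∫⁻ x : Space N, ‖extension f x‖ₑ ^ exponent N

/-- The quotient `∫ |f̌|^q dx / ‖f‖^q`, used for `f ≠ 0` only. -/
def quotient {N : ℕ} (f : L2Sphere N) : ℝ≥0∞ :=
  energy f / ‖f‖ₑ ^ exponent N

/-- The optimal Stein-Tomas constant `R_N`, a supremum in `[0, ∞]`. -/
def steinTomasConst (N : ℕ) : ℝ≥0∞ :=
  ⨆ (f : L2Sphere N) (_ : f ≠ 0), quotient f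

theorem memLp_modulate {N : ℕ} (a : Space N) (f : L2Sphere N) :
    MemLp (fun ω : Sphere N =>
      Complex.exp (-Complex.I * ((inner ℝ a (ω : Space N) : ℝ) : ℂ)) * f ω)
      2 (surfaceMeasure N) := by
  have hc : Continuous (fun ω : Sphere N =>
      Complex.exp (-Complex.I * ((inner ℝ a (ω : Space N) : ℝ) : ℂ))) := by
    fun_prop
  refine (Lp.memLp f).of_le (hc.aestronglyMeasurable.mul (Lp.aestronglyMeasurable f)) ?_
  refine Eventually.of_forall fun ω => ?_
  simp [Complex.norm_exp]

/-- The modulated function `ω ↦ e^{-i a·ω} f(ω)` as an element of `L²(𝕊^{N-1})`. -/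
def modulate {N : ℕ} (a : Space N) (f : L2Sphere N) : L2Sphere N :=
  (memLp_modulate a f).toLp

/-- `f_n ⇀_mod 0`: for every sequence `(a_n)` in `ℝ^N`, the modulated functions
`e^{-i a_n·ω} f_n` converge to `0` weakly in `L²(𝕊^{N-1})`. -/
def WeaklyNullMod {N : ℕ} (f : ℕ → L2Sphere N) : Prop :=
  ∀ a : ℕ → Space N,
    Tendsto (fun n => toWeakSpace ℂ (L2Sphere N) (modulate (a n) (f n))) atTop (𝓝 0)

/-- The constant `R_N^*`, a supremum in `[0, ∞]`. -/
def steinTomasConstStar (N : ℕ) : ℝ≥0∞ :=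
  ⨆ (f : ℕ → L2Sphere N) (_ : ∀ n, ‖f n‖ = 1) (_ : WeaklyNullMod f),
    limsup (fun n => energy (f n)) atTop

/-- Precompactness in `L²(𝕊^{N-1})` up to modulations. -/
def PrecompactUpToModulations {N : ℕ} (f : ℕ → L2Sphere N) : Prop :=
  ∃ (φ : ℕ → ℕ) (a : ℕ → Space N) (g : L2Sphere N), StrictMono φ ∧
    Tendsto (fun k => modulate (a k) (f (φ k))) atTop (𝓝 g)

/-- A maximizing sequence for `R_N`, normalized in `L²(𝕊^{N-1})`. -/
def IsNormalizedMaximizingSeq {N : ℕ} (f : ℕ → L2Sphere N) : Prop :=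
  (∀ n, ‖f n‖ = 1) ∧ Tendsto (fun n => quotient (f n)) atTop (𝓝 (steinTomasConst N))

/-- A maximizer for `R_N`: a nonzero function at which the supremum is attained. -/
def IsMaximizer {N : ℕ} (f : L2Sphere N) : Prop :=
  f ≠ 0 ∧ quotient f = steinTomasConst N

end

end SteinTomas

namespace SteinTomas

noncomputable section

/-! ### Weak convergence in Hilbert space -/

section Hilbert

variable {H : Type*} [NormedAddCommGroup H] [InnerProductSpace ℂ H]

/-! The argument is the missing mass method. The gap prevents a normalized maximizing sequence from
being weakly null modulo modulations, so suitable modulations have a subsequence `u n` with a weak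
limit `g ≠ 0`. Modulation preserves both norm and energy. Weak convergence makes the extensions
converge pointwise, and a Brezis-Lieb inequality gives `R ≤ R y^q + energy g ≤ R (y^q + ‖g‖^q)`,
where `y` is the limit of `‖u n - g‖` and `y² + ‖g‖² = 1` (`steinTomasConst_le_of_weak`). As `q > 2`
and `‖g‖ > 0`, this forces `y = 0`: convergence is strong and `g` is a maximizer.

Dividing by `R` requires `R < ∞`. The Stein-Tomas inequality is not invoked for this: if `R = ∞`,
compactness of the sphere yields functions concentrating at a point with unbounded energy, so that
`R* = ∞` too, against the gap (`steinTomasConstStar_eq_top`). -/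

theorem tendsto_toWeakSpace_zero_iff [CompleteSpace H] {u : ℕ → H} :
    Tendsto (fun n => toWeakSpace ℂ H (u n)) atTop (𝓝 0) ↔
      ∀ h : H, Tendsto (fun n => inner ℂ h (u n)) atTop (𝓝 0) := by
  have hinj : Function.Injective (topDualPairing ℂ H).flip := by
    intro x y hxy
    refine ext_inner_left ℂ fun h => ?_
    exact congrArg (fun l => l (InnerProductSpace.toDual ℂ H h)) hxy
  have key := WeakBilin.tendsto_iff_forall_eval_tendsto (l := atTop)
    (f := fun n => toWeakSpace ℂ H (u n)) (x := 0) (topDualPairing ℂ H).flip hinj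
  refine key.trans ⟨fun h y => ?_, fun h y => ?_⟩
  · rw [← inner_zero_right (𝕜 := ℂ) y]
    exact h (InnerProductSpace.toDual ℂ H y)
  · obtain ⟨z, rfl⟩ := (InnerProductSpace.toDual ℂ H).surjective y
    have := h z
    rw [← inner_zero_right (𝕜 := ℂ) z] at this
    exact this

/-- Sequential Banach-Alaoglu, carried over by Riesz; the Riesz map is conjugate-linear, hence the
conjugations. -/
theorem exists_weakly_convergent_subseq [CompleteSpace H] [TopologicalSpace.SeparableSpace H]
    {u : ℕ → H}
    (hu : ∀ n, ‖u n‖ ≤ 1) :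
    ∃ (g : H) (φ : ℕ → ℕ), StrictMono φ ∧
      ∀ h : H, Tendsto (fun n => inner ℂ h (u (φ n))) atTop (𝓝 (inner ℂ h g)) := by
  obtain ⟨v, -, φ, hφ, hv⟩ := WeakDual.isSeqCompact_closedBall ℂ H 0 1
    (x := fun n => StrongDual.toWeakDual (InnerProductSpace.toDual ℂ H (u n)))
    (fun n => by simpa using hu n)
  refine ⟨(InnerProductSpace.toDual ℂ H).symm (WeakDual.toStrongDual v), φ, hφ, fun h => ?_⟩
  have h1 := tendsto_iff_forall_eval_tendsto_topDualPairing.1 hv h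
  have h2 := (Complex.continuous_conj.tendsto _).comp h1
  have h3 : inner ℂ h ((InnerProductSpace.toDual ℂ H).symm (WeakDual.toStrongDual v)) =
      (starRingEnd ℂ) (topDualPairing ℂ H v h) := by
    rw [← inner_conj_symm, InnerProductSpace.toDual_symm_apply]
    rfl
  rw [h3]
  refine h2.congr fun n => ?_
  rw [← inner_conj_symm]
  rfl

/-- Expand the square and test weak convergence against `g` itself. -/
theorem tendsto_norm_sub_of_weak {u : ℕ → H} {g : H} (hu : ∀ n, ‖u n‖ = 1)
    (hw : ∀ h : H, Tendsto (fun n => inner ℂ h (u n)) atTop (𝓝 (inner ℂ h g))) :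
    ‖g‖ ≤ 1 ∧ Tendsto (fun n => ‖u n - g‖) atTop (𝓝 (√(1 - ‖g‖ ^ 2))) := by
  have h1 : Tendsto (fun n => RCLike.re (inner ℂ g (u n))) atTop (𝓝 (‖g‖ ^ 2)) := by
    have := (Complex.continuous_re.tendsto _).comp (hw g)
    rw [← inner_self_eq_norm_sq (𝕜 := ℂ)]
    exact this
  have h2 : Tendsto (fun n => ‖u n - g‖ ^ 2) atTop (𝓝 (1 - ‖g‖ ^ 2)) := by
    have := ((h1.const_mul 2).const_sub 1).add_const (‖g‖ ^ 2)
    rw [show 1 - 2 * ‖g‖ ^ 2 + ‖g‖ ^ 2 = 1 - ‖g‖ ^ 2 by ring] at this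
    refine this.congr fun n => ?_
    rw [norm_sub_sq (𝕜 := ℂ), hu n, inner_re_symm]
    ring
  constructor
  · have := ge_of_tendsto' h2 fun n => sq_nonneg ‖u n - g‖
    nlinarith [norm_nonneg g]
  · refine ((Real.continuous_sqrt.tendsto _).comp h2).congr fun n => ?_
    simp [Real.sqrt_sq]

end Hilbert

/-! ### A Brezis-Lieb inequality -/

section BrezisLieb

/-- Convexity of `t ^ p` at the points `a / w₁` and `b / w₂`. -/
theorem add_rpow_le_of_weights {w₁ w₂ : ℝ≥0∞} (hw : w₁ + w₂ = 1) (h₁ : w₁ ≠ 0)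
    (h₂ : w₂ ≠ 0) {p : ℝ} (hp : 1 ≤ p) (a b : ℝ≥0∞) :
    (a + b) ^ p ≤ w₁ ^ (1 - p) * a ^ p + w₂ ^ (1 - p) * b ^ p := by
  have t₁ : w₁ ≠ ∞ := ne_top_of_le_ne_top ENNReal.one_ne_top (hw ▸ le_self_add)
  have t₂ : w₂ ≠ ∞ := ne_top_of_le_ne_top ENNReal.one_ne_top (hw ▸ le_add_self)
  have aux : ∀ w c : ℝ≥0∞, w ≠ 0 → w ≠ ∞ → w * (w⁻¹ * c) ^ p = w ^ (1 - p) * c ^ p := by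
    intro w c h0 ht
    rw [ENNReal.mul_rpow_of_nonneg _ _ (by linarith), ← mul_assoc, ENNReal.inv_rpow,
      ENNReal.rpow_sub _ _ h0 ht, ENNReal.rpow_one, ENNReal.div_eq_inv_mul, mul_comm w]
  have := ENNReal.rpow_arith_mean_le_arith_mean2_rpow w₁ w₂ (w₁⁻¹ * a) (w₂⁻¹ * b) hw hp
  rwa [aux _ _ h₁ t₁, aux _ _ h₂ t₂, ← mul_assoc, ← mul_assoc, ENNReal.mul_inv_cancel h₁ t₁,
    ENNReal.mul_inv_cancel h₂ t₂, one_mul, one_mul] at this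

/-- A one-sided form of the Brezis-Lieb lemma. -/
theorem exists_error_lintegral_rpow_le {α E : Type*} [MeasurableSpace α] {μ : Measure α}
    [NormedAddCommGroup E] [MeasurableSpace E] [BorelSpace E] [SecondCountableTopology E]
    {F : ℕ → α → E} {G : α → E} (hF : ∀ n, Measurable (F n)) (hG : Measurable G)
    (hlim : ∀ x, Tendsto (fun n => F n x) atTop (𝓝 (G x))) {p : ℝ} (hp : 1 ≤ p)
    (hfin : ∫⁻ x, ‖G x‖ₑ ^ p ∂μ ≠ ∞) {w₁ w₂ : ℝ≥0∞} (hw : w₁ + w₂ = 1) (h₁ : w₁ ≠ 0)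
    (h₂ : w₂ ≠ 0) :
    ∃ e : ℕ → ℝ≥0∞, Tendsto e atTop (𝓝 0) ∧ ∀ n, ∫⁻ x, ‖F n x‖ₑ ^ p ∂μ ≤
      w₁ ^ (1 - p) * ∫⁻ x, ‖F n x - G x‖ₑ ^ p ∂μ + ∫⁻ x, ‖G x‖ₑ ^ p ∂μ + e n := by
  have t₁ : w₁ ≠ ∞ := ne_top_of_le_ne_top ENNReal.one_ne_top (hw ▸ le_self_add)
  have t₂ : w₂ ≠ ∞ := ne_top_of_le_ne_top ENNReal.one_ne_top (hw ▸ le_add_self)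
  have hp0 : 0 < p := by linarith
  have c₁ : w₁ ^ (1 - p) ≠ ∞ := ENNReal.rpow_ne_top_of_ne_zero h₁ t₁
  have c₂ : w₂ ^ (1 - p) ≠ ∞ := ENNReal.rpow_ne_top_of_ne_zero h₂ t₂
  -- Truncated subtraction keeps only the positive excess. It is dominated by `w₂ ^ (1 - p) * ‖G‖ ^
  -- p`, so no integrability of `F n` is needed.
  set W : ℕ → α → ℝ≥0∞ := fun n x =>
    ‖F n x‖ₑ ^ p - (w₁ ^ (1 - p) * ‖F n x - G x‖ₑ ^ p + ‖G x‖ₑ ^ p)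
  have mF : ∀ n, Measurable fun x => ‖F n x‖ₑ ^ p := fun n => (hF n).enorm.pow_const p
  have mD : ∀ n, Measurable fun x => ‖F n x - G x‖ₑ ^ p :=
    fun n => ((hF n).sub hG).enorm.pow_const p
  have mG : Measurable fun x => ‖G x‖ₑ ^ p := hG.enorm.pow_const p
  refine ⟨fun n => ∫⁻ x, W n x ∂μ, ?_, fun n => ?_⟩
  · have := tendsto_lintegral_of_dominated_convergence (μ := μ) (F := W) (f := fun _ => 0)
      (fun x => w₂ ^ (1 - p) * ‖G x‖ₑ ^ p)
      (fun n => (mF n).sub (((mD n).const_mul _).add mG))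
      (fun n => Eventually.of_forall fun x => ?_) ?_ (Eventually.of_forall fun x => ?_)
    · simpa using this
    · refine tsub_le_iff_right.2 ?_
      have h := add_rpow_le_of_weights hw h₁ h₂ hp ‖F n x - G x‖ₑ ‖G x‖ₑ
      have h' : ‖F n x‖ₑ ≤ ‖F n x - G x‖ₑ + ‖G x‖ₑ := by
        simpa using enorm_add_le (F n x - G x) (G x)
      calc ‖F n x‖ₑ ^ p ≤ (‖F n x - G x‖ₑ + ‖G x‖ₑ) ^ p := by gcongr
        _ ≤ _ := h
        _ ≤ _ := by rw [add_comm]; gcongr; exact le_self_add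
    · rw [lintegral_const_mul _ mG]
      exact ENNReal.mul_ne_top c₂ hfin
    · have e1 : Tendsto (fun n => ‖F n x‖ₑ ^ p) atTop (𝓝 (‖G x‖ₑ ^ p)) :=
        ((ENNReal.continuous_rpow_const.comp continuous_enorm).tendsto _).comp (hlim x)
      have e2 : Tendsto (fun n => ‖F n x - G x‖ₑ ^ p) atTop (𝓝 0) := by
        have := ((ENNReal.continuous_rpow_const (y := p).comp continuous_enorm).tendsto _).comp
          ((hlim x).sub_const (G x))
        simpa [Function.comp_def, ENNReal.zero_rpow_of_pos hp0] using this
      have e3 := (ENNReal.Tendsto.const_mul (a := w₁ ^ (1 - p)) e2 (Or.inr c₁)).add_const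
        (‖G x‖ₑ ^ p)
      have hGx : ‖G x‖ₑ ^ p ≠ ∞ := ENNReal.rpow_ne_top_of_nonneg hp0.le enorm_ne_top
      have := ENNReal.Tendsto.sub e1 e3 (Or.inl hGx)
      simpa using this
  · rw [← lintegral_const_mul _ (mD n), ← lintegral_add_left ((mD n).const_mul _)]
    refine (lintegral_mono fun x => ?_).trans
      (lintegral_add_left (((mD n).const_mul (w₁ ^ (1 - p))).add mG) (W n)).le
    exact le_add_tsub

end BrezisLieb

/-- If both were positive, both would lie in `(0, 1)`, where `t ^ q < t ^ 2`. -/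
theorem eq_zero_of_one_le_rpow_add_rpow {x y q : ℝ} (hx : 0 < x) (hy : 0 ≤ y)
    (hxy : x ^ 2 + y ^ 2 = 1) (hq : 2 < q) (h : 1 ≤ x ^ q + y ^ q) : y = 0 := by
  by_contra hy0
  have hy' : 0 < y := lt_of_le_of_ne hy (Ne.symm hy0)
  have aux : ∀ t : ℝ, 0 < t → t < 1 → t ^ q < t ^ 2 := fun t h0 h1 => by
    rw [← Real.rpow_natCast]
    exact Real.rpow_lt_rpow_of_exponent_gt h0 h1 (by simpa using hq)
  have := aux x hx (by nlinarith)
  have := aux y hy' (by nlinarith)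
  linarith

/-! ### The extension operator and its symmetries -/

variable {N : ℕ}

theorem exponent_gt_two (hN : 2 ≤ N) : 2 < exponent N := by
  have h : (2 : ℝ) ≤ N := by exact_mod_cast hN
  rw [exponent, lt_div_iff₀ (by linarith)]
  linarith

theorem norm_exp_neg_I_mul_inner (a b : Space N) :
    ‖Complex.exp (-Complex.I * ((inner ℝ a b : ℝ) : ℂ))‖ = 1 := by
  simp [Complex.norm_exp]

/-- The element `ω ↦ e^{-i x·ω}` of `L²(𝕊^{N-1})`. -/
def planeWave (x : Space N) : L2Sphere N :=
  modulate x ((memLp_const (1 : ℂ)).toLp)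

theorem coeFn_modulate (a : Space N) (f : L2Sphere N) :
    modulate a f =ᵐ[surfaceMeasure N] fun ω =>
      Complex.exp (-Complex.I * ((inner ℝ a (ω : Space N) : ℝ) : ℂ)) * f ω :=
  MemLp.coeFn_toLp _

theorem coeFn_planeWave (x : Space N) :
    planeWave x =ᵐ[surfaceMeasure N] fun ω =>
      Complex.exp (-Complex.I * ((inner ℝ x (ω : Space N) : ℝ) : ℂ)) := by
  refine (coeFn_modulate x _).trans ?_
  filter_upwards [(memLp_const (μ := surfaceMeasure N) (p := 2) (1 : ℂ)).coeFn_toLp] with ω h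
  rw [h, mul_one]

theorem norm_modulate (a : Space N) (f : L2Sphere N) : ‖modulate a f‖ = ‖f‖ := by
  have h : ∀ᵐ ω ∂surfaceMeasure N, ‖modulate a f ω‖ = ‖f ω‖ := by
    filter_upwards [coeFn_modulate a f] with ω h
    rw [h, norm_mul, norm_exp_neg_I_mul_inner, one_mul]
  exact le_antisymm (Lp.norm_le_norm_of_ae_le (h.mono fun _ h => h.le))
    (Lp.norm_le_norm_of_ae_le (h.mono fun _ h => h.ge))

/-- Linearity in `f` and pointwise convergence under weak limits both follow from this form. -/
theorem extension_eq_inner (f : L2Sphere N) (x : Space N) :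
    extension f x = (((2 * Real.pi) ^ (-(N : ℝ) / 2) : ℝ) : ℂ) * inner ℂ (planeWave x) f := by
  rw [extension, L2.inner_def]
  congr 1
  refine integral_congr_ae ?_
  filter_upwards [coeFn_planeWave x] with ω h
  simp only [RCLike.inner_apply, h, ← Complex.exp_conj, map_mul, map_neg, Complex.conj_I,
    Complex.conj_ofReal, neg_neg]
  ring

theorem extension_add (f g : L2Sphere N) (x : Space N) :
    extension (f + g) x = extension f x + extension g x := by
  simp only [extension_eq_inner, inner_add_right, mul_add]

theorem extension_sub (f g : L2Sphere N) (x : Space N) :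
    extension (f - g) x = extension f x - extension g x := by
  simp only [extension_eq_inner, inner_sub_right, mul_sub]

theorem extension_smul (c : ℂ) (f : L2Sphere N) (x : Space N) :
    extension (c • f) x = c * extension f x := by
  simp only [extension_eq_inner, inner_smul_right]
  ring

theorem extension_modulate (a : Space N) (f : L2Sphere N) (x : Space N) :
    extension (modulate a f) x = extension f (x - a) := by
  rw [extension, extension]
  congr 1
  refine integral_congr_ae ?_
  filter_upwards [coeFn_modulate a f] with ω h
  rw [h, ← mul_assoc, ← Complex.exp_add, inner_sub_left]
  congr 2
  push_cast
  ring

theorem continuous_extension (f : L2Sphere N) : Continuous (extension f) := by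
  refine continuous_const.mul (continuous_of_dominated (bound := fun ω => ‖f ω‖)
    (fun x => ?_) (fun x => ?_) ?_ ?_)
  · have : Continuous fun ω : Sphere N =>
        Complex.exp (Complex.I * ((inner ℝ x (ω : Space N) : ℝ) : ℂ)) := by fun_prop
    exact this.aestronglyMeasurable.mul (Lp.aestronglyMeasurable f)
  · exact Eventually.of_forall fun ω => by simp [Complex.norm_exp]
  · exact ((Lp.memLp f).integrable (by norm_num)).norm
  · exact Eventually.of_forall fun ω => by fun_prop

theorem measurable_extension (f : L2Sphere N) : Measurable (extension f) :=
  (continuous_extension f).measurable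

theorem energy_modulate (a : Space N) (f : L2Sphere N) : energy (modulate a f) = energy f := by
  simp only [energy, extension_modulate]
  exact lintegral_sub_right_eq_self (fun x => ‖extension f x‖ₑ ^ exponent N) a

theorem energy_smul (hN : 2 ≤ N) (c : ℂ) (f : L2Sphere N) :
    energy (c • f) = ‖c‖ₑ ^ exponent N * energy f := by
  have hq := exponent_gt_two hN
  simp only [energy, extension_smul, enorm_mul]
  rw [← lintegral_const_mul _ ((measurable_extension f).enorm.pow_const _)]
  exact lintegral_congr fun x => ENNReal.mul_rpow_of_nonneg _ _ (by linarith)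

theorem energy_add_le (hN : 2 ≤ N) (f g : L2Sphere N) :
    energy (f + g) ≤ 2 ^ (exponent N - 1) * (energy f + energy g) := by
  have hq := exponent_gt_two hN
  have mf := (measurable_extension f).enorm.pow_const (exponent N)
  have mg := (measurable_extension g).enorm.pow_const (exponent N)
  have mfg : Measurable fun x => ‖extension f x‖ₑ ^ exponent N + ‖extension g x‖ₑ ^ exponent N :=
    mf.add mg
  simp only [energy, extension_add]
  rw [← lintegral_add_left mf, ← lintegral_const_mul _ mfg]
  refine lintegral_mono fun x => ?_
  refine le_trans ?_ (ENNReal.rpow_add_le_mul_rpow_add_rpow _ _ (by linarith))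
  exact ENNReal.rpow_le_rpow (enorm_add_le _ _) (by linarith)

theorem quotient_of_norm_eq_one {f : L2Sphere N} (hf : ‖f‖ = 1) : quotient f = energy f := by
  have : ‖f‖ₑ = 1 := by rw [← ofReal_norm, hf, ENNReal.ofReal_one]
  simp [quotient, this]

theorem energy_zero (hN : 2 ≤ N) : energy (0 : L2Sphere N) = 0 := by
  have hq := exponent_gt_two hN
  simpa [ENNReal.zero_rpow_of_pos (show 0 < exponent N by linarith)] using
    energy_smul hN 0 (0 : L2Sphere N)

/-- The normalization `f / ‖f‖`. -/
def normalize (f : L2Sphere N) : L2Sphere N := ((‖f‖⁻¹ : ℝ) : ℂ) • f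

theorem norm_normalize {f : L2Sphere N} (hf : f ≠ 0) : ‖normalize f‖ = 1 := by
  rw [normalize, norm_smul, Complex.norm_real, norm_inv, norm_norm,
    inv_mul_cancel₀ (norm_ne_zero_iff.2 hf)]

theorem energy_normalize (hN : 2 ≤ N) {f : L2Sphere N} (hf : f ≠ 0) :
    energy (normalize f) = quotient f := by
  have h0 : ‖f‖ₑ ≠ 0 := by simpa using hf
  rw [normalize, energy_smul hN, quotient, ENNReal.div_eq_inv_mul, ← ENNReal.inv_rpow]
  congr 2
  rw [Complex.ofReal_inv, enorm_inv (by simpa using hf)]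
  congr 1
  rw [← ofReal_norm, ← ofReal_norm]
  simp

theorem energy_le (hN : 2 ≤ N) (f : L2Sphere N) :
    energy f ≤ steinTomasConst N * ‖f‖ₑ ^ exponent N := by
  have hq := exponent_gt_two hN
  by_cases hf : f = 0
  · rw [hf, energy_zero hN]
    exact zero_le
  have h0 : ‖f‖ₑ ≠ 0 := by simpa using hf
  have h : quotient f ≤ steinTomasConst N := le_iSup₂ (f := fun f (_ : f ≠ 0) => quotient f) f hf
  rw [quotient] at h
  exact (ENNReal.div_le_iff (by simp [ENNReal.rpow_eq_zero_iff, h0])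
    (ENNReal.rpow_ne_top_of_nonneg (by linarith) enorm_ne_top)).1 h

theorem tendsto_extension_of_weak {u : ℕ → L2Sphere N} {g : L2Sphere N}
    (hw : ∀ h : L2Sphere N, Tendsto (fun n => inner ℂ h (u n)) atTop (𝓝 (inner ℂ h g)))
    (x : Space N) : Tendsto (fun n => extension (u n) x) atTop (𝓝 (extension g x)) := by
  simp only [extension_eq_inner]
  exact (hw _).const_mul _

/-! ### Localization on the sphere and finiteness of the constant -/

theorem surfaceMeasure_singleton (hN : 2 ≤ N) (x : Sphere N) : surfaceMeasure N {x} = 0 := by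
  rw [Measure.toSphere_apply' _ (measurableSet_singleton x)]
  -- The cone over a point lies in a line, a proper subspace because `N ≥ 2`.
  refine mul_eq_zero_of_right _ (measure_mono_null ?_
    (Measure.addHaar_submodule volume (Submodule.span ℝ {(x : Space N)}) ?_))
  · rintro _ ⟨t, -, _, ⟨y, rfl, rfl⟩, rfl⟩
    exact Submodule.smul_mem _ _ (Submodule.mem_span_singleton_self _)
  · intro h
    have h1 := finrank_span_le_card (R := ℝ) ({(x : Space N)} : Set (Space N))
    rw [h, finrank_top, finrank_euclideanSpace_fin] at h1
    simp at h1
    omega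

/-- The product `1_S f` as an element of `L²(𝕊^{N-1})`. -/
def cutoff {S : Set (Sphere N)} (hS : MeasurableSet S) (f : L2Sphere N) : L2Sphere N :=
  ((Lp.memLp f).indicator hS).toLp

section cutoff

variable {S T : Set (Sphere N)} (hS : MeasurableSet S) (hT : MeasurableSet T)

theorem coeFn_cutoff (f : L2Sphere N) : cutoff hS f =ᵐ[surfaceMeasure N] S.indicator f :=
  MemLp.coeFn_toLp _

theorem norm_cutoff_le (f : L2Sphere N) : ‖cutoff hS f‖ ≤ ‖f‖ := by
  refine Lp.norm_le_norm_of_ae_le ?_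
  filter_upwards [coeFn_cutoff hS f] with ω h
  rw [h]
  exact norm_indicator_le_norm_self _ _

theorem cutoff_union (f : L2Sphere N) :
    cutoff (hS.union hT) f = cutoff hS f + cutoff hT (cutoff hS.compl f) := by
  refine Lp.ext ?_
  filter_upwards [coeFn_cutoff (hS.union hT) f, coeFn_cutoff hS f, coeFn_cutoff hS.compl f,
    coeFn_cutoff hT (cutoff hS.compl f), Lp.coeFn_add (cutoff hS f) (cutoff hT (cutoff hS.compl f))]
    with ω h1 h2 h3 h4 h5
  rw [h1, h5, Pi.add_apply, h2, h4]
  by_cases a : ω ∈ S <;> by_cases b : ω ∈ T <;> simp [a, b, h3]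

theorem cutoff_univ (f : L2Sphere N) : cutoff MeasurableSet.univ f = f := by
  refine Lp.ext ?_
  filter_upwards [coeFn_cutoff MeasurableSet.univ f] with ω h
  rw [h, Set.indicator_univ]

theorem inner_modulate_cutoff (a : Space N) (h f : L2Sphere N) :
    inner ℂ h (modulate a (cutoff hS f)) = inner ℂ (cutoff hS h) (modulate a (cutoff hS f)) := by
  rw [L2.inner_def, L2.inner_def]
  refine integral_congr_ae ?_
  filter_upwards [coeFn_modulate a (cutoff hS f), coeFn_cutoff hS f, coeFn_cutoff hS h]
    with ω h1 h2 h3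
  rw [h1, h2, h3]
  by_cases b : ω ∈ S <;> simp [b]

theorem cutoff_smul (c : ℂ) (f : L2Sphere N) : cutoff hS (c • f) = c • cutoff hS f := by
  refine Lp.ext ?_
  filter_upwards [coeFn_cutoff hS f, coeFn_cutoff hS (c • f), Lp.coeFn_smul c f,
    Lp.coeFn_smul c (cutoff hS f)] with ω h1 h2 h3 h4
  rw [h2, h4, Pi.smul_apply, h1]
  by_cases b : ω ∈ S <;> simp [b, h3]

end cutoff

theorem tendsto_cutoff_zero {S : ℕ → Set (Sphere N)} (hS : ∀ n, MeasurableSet (S n))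
    (hμ : Tendsto (fun n => surfaceMeasure N (S n)) atTop (𝓝 0)) (f : L2Sphere N) :
    Tendsto (fun n => ‖cutoff (hS n) f‖) atTop (𝓝 0) := by
  refine (nhds_basis_Icc_pos (0 : ℝ)).tendsto_right_iff.2 fun ε hε => ?_
  obtain ⟨δ, hδ, h⟩ := (Lp.memLp f).eLpNorm_indicator_le (by norm_num) (by norm_num) hε
  filter_upwards [hμ.eventually_le_const (ENNReal.ofReal_pos.2 hδ)] with n hn
  refine ⟨by linarith [norm_nonneg (cutoff (hS n) f)], ?_⟩
  rw [zero_add, cutoff, Lp.norm_toLp]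
  exact ENNReal.toReal_le_of_le_ofReal hε.le (h _ (hS n) hn)

/-- Modulation preserves supports and norms, so Cauchy-Schwarz bounds the pairing with `h` by the
norm of `h` on `S n`, whatever the modulations. -/
theorem weaklyNullMod_of_support {S : ℕ → Set (Sphere N)} (hS : ∀ n, MeasurableSet (S n))
    (hμ : Tendsto (fun n => surfaceMeasure N (S n)) atTop (𝓝 0)) {f : ℕ → L2Sphere N}
    (hf : ∀ n, ‖f n‖ = 1) (hfS : ∀ n, ∃ g, f n = cutoff (hS n) g) : WeaklyNullMod f := by
  intro a
  refine tendsto_toWeakSpace_zero_iff.2 fun h => ?_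
  refine squeeze_zero_norm (fun n => ?_) (tendsto_cutoff_zero hS hμ h)
  obtain ⟨g, hg⟩ := hfS n
  have h1 := hf n
  rw [hg] at h1 ⊢
  rw [inner_modulate_cutoff]
  refine (norm_inner_le_norm _ _).trans ?_
  rw [norm_modulate, h1, mul_one]

/-- The energy is bounded on the unit ball of the functions supported in some measurable set
containing `S`. -/
def EnergyBoundedOn (S : Set (Sphere N)) : Prop :=
  ∃ (T : Set (Sphere N)) (hT : MeasurableSet T), S ⊆ T ∧ ∃ K : ℝ≥0∞, K ≠ ∞ ∧
    ∀ f : L2Sphere N, ‖f‖ ≤ 1 → energy (cutoff hT f) ≤ K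

theorem EnergyBoundedOn.union (hN : 2 ≤ N) {S₁ S₂ : Set (Sphere N)} (h₁ : EnergyBoundedOn S₁)
    (h₂ : EnergyBoundedOn S₂) : EnergyBoundedOn (S₁ ∪ S₂) := by
  have hq := exponent_gt_two hN
  obtain ⟨T₁, m₁, s₁, K₁, k₁, b₁⟩ := h₁
  obtain ⟨T₂, m₂, s₂, K₂, k₂, b₂⟩ := h₂
  refine ⟨T₁ ∪ T₂, m₁.union m₂, Set.union_subset_union s₁ s₂,
    2 ^ (exponent N - 1) * (K₁ + K₂), ?_, fun f hf => ?_⟩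
  · exact ENNReal.mul_ne_top (ENNReal.rpow_ne_top_of_nonneg (by linarith) (by norm_num))
      (ENNReal.add_ne_top.2 ⟨k₁, k₂⟩)
  · rw [cutoff_union m₁ m₂]
    refine (energy_add_le hN _ _).trans ?_
    gcongr
    · exact b₁ f hf
    · exact b₂ _ ((norm_cutoff_le _ f).trans hf)

theorem energyBoundedOn_empty (hN : 2 ≤ N) : EnergyBoundedOn (∅ : Set (Sphere N)) := by
  refine ⟨∅, MeasurableSet.empty, subset_rfl, 0, by simp, fun f _ => ?_⟩
  have : cutoff MeasurableSet.empty f = 0 := by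
    refine Lp.ext ?_
    filter_upwards [coeFn_cutoff MeasurableSet.empty f, Lp.coeFn_zero ℂ 2 (surfaceMeasure N)]
      with ω h1 h2
    rw [h1, h2]
    simp
  rw [this, energy_zero hN]

theorem exists_point_not_energyBoundedOn (hN : 2 ≤ N) (hR : steinTomasConst N = ∞) :
    ∃ x : Sphere N, ∀ t ∈ 𝓝 x, ¬ EnergyBoundedOn t := by
  by_contra! hcon
  have huniv : EnergyBoundedOn (Set.univ : Set (Sphere N)) := by
    -- Compact induction runs over arbitrary subsets; the measurable superset in `EnergyBoundedOn`
    -- makes the property monotone.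
    refine isCompact_univ.induction_on (energyBoundedOn_empty hN) ?_
      (fun s t => EnergyBoundedOn.union hN) fun x _ => ?_
    · rintro s t hst ⟨T, hT, htT, h⟩
      exact ⟨T, hT, hst.trans htT, h⟩
    · obtain ⟨t, ht, h⟩ := hcon x
      exact ⟨t, mem_nhdsWithin_of_mem_nhds ht, h⟩
  obtain ⟨T, hT, hsub, K, hK, hb⟩ := huniv
  obtain rfl := Set.univ_subset_iff.1 hsub
  refine hK (top_le_iff.1 (hR ▸ iSup₂_le fun f hf => ?_))
  rw [← energy_normalize hN hf, ← cutoff_univ (normalize f)]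
  exact hb _ (norm_normalize hf).le

theorem steinTomasConstStar_eq_top (hN : 2 ≤ N) (hR : steinTomasConst N = ∞) :
    steinTomasConstStar N = ∞ := by
  have hq := exponent_gt_two hN
  obtain ⟨x, hx⟩ := exists_point_not_energyBoundedOn hN hR
  set S : ℕ → Set (Sphere N) := fun n => Metric.ball x (1 / ((n : ℝ) + 1))
  have hS : ∀ n, MeasurableSet (S n) := fun n => measurableSet_ball
  have hμ : Tendsto (fun n => surfaceMeasure N (S n)) atTop (𝓝 0) := by
    have h := tendsto_measure_iInter_atTop (μ := surfaceMeasure N) (s := S)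
      (fun n => (hS n).nullMeasurableSet)
      (fun m n hmn => Metric.ball_subset_ball (Nat.one_div_le_one_div hmn))
      ⟨0, measure_ne_top _ _⟩
    have hI : ⋂ n, S n = {x} := by
      refine Set.eq_singleton_iff_unique_mem.2 ⟨Set.mem_iInter.2 fun n =>
        Metric.mem_ball_self Nat.one_div_pos_of_nat, fun y hy => ?_⟩
      refine dist_le_zero.1 (ge_of_tendsto' tendsto_one_div_add_atTop_nhds_zero_nat fun n => ?_)
      exact (Metric.mem_ball.1 (Set.mem_iInter.1 hy n)).le
    rwa [hI, surfaceMeasure_singleton hN] at h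
  have key : ∀ n : ℕ, ∃ g : L2Sphere N, ‖cutoff (hS n) g‖ = 1 ∧
      (n : ℝ≥0∞) ≤ energy (cutoff (hS n) g) := by
    intro n
    have hn := hx (S n) (Metric.ball_mem_nhds x Nat.one_div_pos_of_nat)
    have : ∃ f : L2Sphere N, ‖f‖ ≤ 1 ∧ (n : ℝ≥0∞) < energy (cutoff (hS n) f) := by
      by_contra! hcon
      exact hn ⟨S n, hS n, subset_rfl, n, ENNReal.natCast_ne_top n, hcon⟩
    obtain ⟨f, hf, hE⟩ := this
    have h0 : cutoff (hS n) f ≠ 0 := by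
      intro h
      rw [h, energy_zero hN] at hE
      exact not_lt_zero hE
    refine ⟨((‖cutoff (hS n) f‖⁻¹ : ℝ) : ℂ) • f, ?_⟩
    rw [cutoff_smul]
    change ‖normalize _‖ = 1 ∧ _ ≤ energy (normalize _)
    refine ⟨norm_normalize h0, hE.le.trans ?_⟩
    rw [energy_normalize hN h0, quotient]
    refine ENNReal.le_div_iff_mul_le (Or.inr ?_) (Or.inl ?_) |>.2 ?_
    · exact (lt_of_le_of_lt zero_le hE).ne'
    · exact ENNReal.rpow_ne_top_of_nonneg (by linarith) enorm_ne_top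
    -- The cutoff has norm at most one, so normalizing does not lower its energy.
    · refine mul_le_of_le_one_right' (ENNReal.rpow_le_one ?_ (by linarith))
      rw [← ofReal_norm]
      exact ENNReal.ofReal_le_one.2 ((norm_cutoff_le _ f).trans hf)
  choose g hg1 hgE using key
  have hnull := weaklyNullMod_of_support hS hμ hg1 fun n => ⟨g n, rfl⟩
  refine top_le_iff.1 (le_trans ?_ (le_iSup_of_le _ (le_iSup₂_of_le hg1 hnull le_rfl)))
  have hlim : Tendsto (fun n => energy (cutoff (hS n) (g n))) atTop (𝓝 ∞) :=
    tendsto_nhds_top_mono' ENNReal.tendsto_nat_nhds_top hgE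
  rw [hlim.limsup_eq]

/-! ### Compactness of maximizing sequences -/

theorem separableSpace_L2Sphere : TopologicalSpace.SeparableSpace (L2Sphere N) := by
  have : Fact ((2 : ℝ≥0∞) ≠ ∞) := ⟨by norm_num⟩
  have : SFinite (surfaceMeasure N) := inferInstance
  have : MeasureTheory.IsSeparable (surfaceMeasure N) := inferInstance
  have : SecondCountableTopology (L2Sphere N) := Lp.SecondCountableTopology
  infer_instance

/-- The missing mass inequality: `R_N ≤ R_N y^q + energy g`, where `y` is the limit of the norms
of the remainders. -/
theorem steinTomasConst_le_of_weak (hN : 2 ≤ N) (hR : steinTomasConst N ≠ ∞)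
    {u : ℕ → L2Sphere N} {g : L2Sphere N}
    (hE : Tendsto (fun n => energy (u n)) atTop (𝓝 (steinTomasConst N)))
    (hw : ∀ h : L2Sphere N, Tendsto (fun n => inner ℂ h (u n)) atTop (𝓝 (inner ℂ h g)))
    {y : ℝ} (hy : Tendsto (fun n => ‖u n - g‖) atTop (𝓝 y)) :
    steinTomasConst N ≤ steinTomasConst N * ENNReal.ofReal y ^ exponent N + energy g := by
  have hq := exponent_gt_two hN
  have hg : energy g ≠ ∞ := ne_top_of_le_ne_top (ENNReal.mul_ne_top hR
    (ENNReal.rpow_ne_top_of_nonneg (by linarith) enorm_ne_top)) (energy_le hN g)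
  set M := steinTomasConst N * ENNReal.ofReal y ^ exponent N
  have hMtop : M ≠ ∞ := ENNReal.mul_ne_top hR
    (ENNReal.rpow_ne_top_of_nonneg (by linarith) ENNReal.ofReal_ne_top)
  have hr : Tendsto (fun n => steinTomasConst N * ‖u n - g‖ₑ ^ exponent N) atTop (𝓝 M) := by
    refine ENNReal.Tendsto.const_mul ?_ (Or.inr hR)
    have := (ENNReal.continuous_rpow_const (y := exponent N)).tendsto _ |>.comp
      ((ENNReal.continuous_ofReal.tendsto y).comp hy)
    simpa [Function.comp_def, ofReal_norm] using this
  -- Let `n → ∞` with the weight `w` on the remainder fixed; afterwards `w → 1` removes the factor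
  -- `w ^ (1 - q)`.
  have step : ∀ w : ℝ≥0∞, w ≠ 0 → w < 1 →
      steinTomasConst N ≤ w ^ (1 - exponent N) * M + energy g := by
    intro w h0 h1
    obtain ⟨e, he, hle⟩ := exists_error_lintegral_rpow_le (μ := (volume : Measure (Space N)))
      (fun n => measurable_extension (u n)) (measurable_extension g)
      (tendsto_extension_of_weak hw) (by linarith : 1 ≤ exponent N) hg
      (add_tsub_cancel_of_le h1.le) h0 (tsub_pos_of_lt h1).ne'
    have hlim := ((ENNReal.Tendsto.const_mul (a := w ^ (1 - exponent N)) hr (Or.inr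
      (ENNReal.rpow_ne_top_of_ne_zero h0 h1.ne_top))).add_const (energy g)).add he
    rw [add_zero] at hlim
    refine le_of_tendsto_of_tendsto' hE hlim fun n => (hle n).trans ?_
    simp only [← extension_sub]
    change _ * energy _ + energy g + e n ≤ _
    gcongr
    exact energy_le hN _
  have hlim : Tendsto (fun w : ℝ≥0∞ => w ^ (1 - exponent N) * M + energy g) (𝓝[<] 1)
      (𝓝 (M + energy g)) := by
    have h1 : Tendsto (fun w : ℝ≥0∞ => w ^ (1 - exponent N)) (𝓝[<] 1) (𝓝 1) := by
      have := (ENNReal.continuous_rpow_const (y := 1 - exponent N)).tendsto 1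
      rw [ENNReal.one_rpow] at this
      exact this.mono_left nhdsWithin_le_nhds
    simpa using (ENNReal.Tendsto.mul_const h1 (Or.inr hMtop)).add_const (energy g)
  have : (𝓝[<] (1 : ℝ≥0∞)).NeBot := nhdsLT_neBot_of_exists_lt ⟨0, zero_lt_one⟩
  refine ge_of_tendsto hlim ?_
  have hpos : ∀ᶠ w : ℝ≥0∞ in 𝓝[<] 1, w ≠ 0 :=
    nhdsWithin_le_nhds (isOpen_ne.mem_nhds one_ne_zero)
  filter_upwards [hpos, self_mem_nhdsWithin] with w h0 h1 using step w h0 h1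

theorem tendsto_of_weak_of_maximizing (hN : 2 ≤ N) (hR : steinTomasConst N ≠ ∞)
    (hR0 : steinTomasConst N ≠ 0) {u : ℕ → L2Sphere N} {g : L2Sphere N}
    (hu : ∀ n, ‖u n‖ = 1)
    (hE : Tendsto (fun n => energy (u n)) atTop (𝓝 (steinTomasConst N)))
    (hw : ∀ h : L2Sphere N, Tendsto (fun n => inner ℂ h (u n)) atTop (𝓝 (inner ℂ h g)))
    (hg : g ≠ 0) : Tendsto u atTop (𝓝 g) ∧ IsMaximizer g := by
  have hq := exponent_gt_two hN
  have hq0 : 0 < exponent N := by linarith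
  obtain ⟨hg1, hy⟩ := tendsto_norm_sub_of_weak hu hw
  have hx : 0 < ‖g‖ := norm_pos_iff.2 hg
  have hsq : √(1 - ‖g‖ ^ 2) ^ 2 = 1 - ‖g‖ ^ 2 := Real.sq_sqrt (by nlinarith)
  have hy0 : √(1 - ‖g‖ ^ 2) = 0 := by
    refine eq_zero_of_one_le_rpow_add_rpow hx (Real.sqrt_nonneg _) (by linarith) hq ?_
    have h1 := (steinTomasConst_le_of_weak hN hR hE hw hy).trans
      (add_le_add_right (energy_le hN g) _)
    rw [← mul_add] at h1
    have h2 : 1 ≤ ENNReal.ofReal (√(1 - ‖g‖ ^ 2)) ^ exponent N + ‖g‖ₑ ^ exponent N := by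
      refine (ENNReal.mul_le_mul_iff_right hR0 hR).1 ?_
      rwa [mul_one]
    rw [← ofReal_norm, ENNReal.ofReal_rpow_of_nonneg (Real.sqrt_nonneg _) hq0.le,
      ENNReal.ofReal_rpow_of_nonneg hx.le hq0.le, ← ENNReal.ofReal_add (by positivity)
      (by positivity), ENNReal.one_le_ofReal] at h2
    linarith
  have hg1' : ‖g‖ = 1 := by
    rw [hy0] at hsq
    nlinarith
  refine ⟨?_, hg, ?_⟩
  · rw [hy0] at hy
    exact tendsto_iff_norm_sub_tendsto_zero.2 hy
  · refine le_antisymm (le_iSup₂ (f := fun f (_ : f ≠ 0) => quotient f) g hg) ?_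
    have h := steinTomasConst_le_of_weak hN hR hE hw hy
    rw [hy0, ENNReal.ofReal_zero, ENNReal.zero_rpow_of_pos hq0, mul_zero, zero_add] at h
    rwa [quotient_of_norm_eq_one hg1']

theorem exists_tendsto_of_maximizing (hN : 2 ≤ N)
    (hgap : steinTomasConstStar N < steinTomasConst N) {f : ℕ → L2Sphere N}
    (hf : IsNormalizedMaximizingSeq f) :
    ∃ (φ : ℕ → ℕ) (a : ℕ → Space N) (g : L2Sphere N), StrictMono φ ∧
      Tendsto (fun k => modulate (a k) (f (φ k))) atTop (𝓝 g) ∧ IsMaximizer g := by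
  obtain ⟨hf1, hfq⟩ := hf
  have hE : Tendsto (fun n => energy (f n)) atTop (𝓝 (steinTomasConst N)) :=
    hfq.congr fun n => quotient_of_norm_eq_one (hf1 n)
  have hR : steinTomasConst N ≠ ∞ := fun h =>
    hgap.ne_top (steinTomasConstStar_eq_top hN h)
  have hR0 : steinTomasConst N ≠ 0 := (lt_of_le_of_lt zero_le hgap).ne'
  have hnot : ¬ WeaklyNullMod f := fun hnull => by
    refine hgap.not_ge ?_
    rw [← hE.limsup_eq]
    exact le_iSup_of_le f (le_iSup₂_of_le hf1 hnull le_rfl)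
  simp only [WeaklyNullMod, tendsto_toWeakSpace_zero_iff, not_forall] at hnot
  obtain ⟨a, h, hah⟩ := hnot
  -- Along a subsequence the pairings with `h` stay outside a neighbourhood of `0`, which makes the
  -- weak limit nonzero.
  obtain ⟨s, hs, hfreq⟩ := not_tendsto_iff_exists_frequently_notMem.1 hah
  obtain ⟨ψ, hψ, hψs⟩ := extraction_of_frequently_atTop hfreq
  have := separableSpace_L2Sphere (N := N)
  obtain ⟨g, χ, hχ, hw⟩ := exists_weakly_convergent_subseq
    (u := fun n => modulate (a (ψ n)) (f (ψ n)))
    (fun n => by rw [norm_modulate, hf1])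
  have hg : g ≠ 0 := by
    rintro rfl
    have h1 := hw h
    rw [inner_zero_right] at h1
    obtain ⟨n, hn⟩ := (h1.eventually hs).exists
    exact hψs (χ n) hn
  obtain ⟨h1, h2⟩ := tendsto_of_weak_of_maximizing hN hR hR0
    (u := fun n => modulate (a (ψ (χ n))) (f (ψ (χ n))))
    (fun n => by rw [norm_modulate, hf1])
    (by
      simp only [energy_modulate]
      exact hE.comp (hψ.comp hχ).tendsto_atTop) hw hg
  exact ⟨ψ ∘ χ, a ∘ ψ ∘ χ, g, hψ.comp hχ, h1, h2⟩

theorem exists_normalizedMaximizingSeq (hN : 2 ≤ N) (hR0 : steinTomasConst N ≠ 0) :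
    ∃ f : ℕ → L2Sphere N, IsNormalizedMaximizingSeq f := by
  -- Were the space trivial, the supremum over an empty family would be `0`.
  have hne : ∃ f : L2Sphere N, f ≠ 0 := by
    by_contra! hcon
    refine hR0 (le_antisymm (iSup₂_le fun f hf => absurd (hcon f) hf) zero_le)
  obtain ⟨f₀, hf₀⟩ := hne
  have : Nonempty {f : L2Sphere N // f ≠ 0} := ⟨⟨f₀, hf₀⟩⟩
  have hsup : steinTomasConst N = ⨆ f : {f : L2Sphere N // f ≠ 0}, quotient f.1 := by
    rw [steinTomasConst, iSup_subtype']
  obtain ⟨v, -, hv, hmem⟩ := exists_seq_tendsto_sSup (S := Set.range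
    fun f : {f : L2Sphere N // f ≠ 0} => quotient f.1) (Set.range_nonempty _) (OrderTop.bddAbove _)
  choose u hu using hmem
  refine ⟨fun n => normalize (u n).1, fun n => norm_normalize (u n).2, ?_⟩
  rw [hsup]
  refine hv.congr fun n => ?_
  rw [quotient_of_norm_eq_one (norm_normalize (u n).2), energy_normalize hN (u n).2]
  exact (hu n).symm

end

end SteinTomas

theorem mainTheorem3 (N : ℕ) (hN : 2 ≤ N)
    (hgap : SteinTomas.steinTomasConstStar N < SteinTomas.steinTomasConst N) :
    (∀ f : ℕ → SteinTomas.L2Sphere N, SteinTomas.IsNormalizedMaximizingSeq f →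
      SteinTomas.PrecompactUpToModulations f) ∧
    ∃ f : SteinTomas.L2Sphere N, SteinTomas.IsMaximizer f := by
  constructor
  · intro f hf
    obtain ⟨φ, a, g, hφ, h, -⟩ := SteinTomas.exists_tendsto_of_maximizing hN hgap hf
    exact ⟨φ, a, g, hφ, h⟩
  · obtain ⟨f, hf⟩ := SteinTomas.exists_normalizedMaximizingSeq hN
      (lt_of_le_of_lt zero_le hgap).ne'
    obtain ⟨-, -, g, -, -, hg⟩ := SteinTomas.exists_tendsto_of_maximizing hN hgap hf
    exact ⟨g, hg⟩
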